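/- Let $x^n=(x_1,\dots,x_n)$ be a random vector in $\{0,1\}^n$ with independent components, and put $p_i=\Pr(x_i=1)$. Let $\delta:\{0,1\}\times\{0,1\}\to\mathbb{R}_{\ge 0}$ be the letter-by-letter distortion measure $$\delta(0,0)=1,\quad \delta(0,1)=2,\quad \delta(1,0)=1,\quad \delta(1,1)=0,$$ and let $d(x^n,\hat x^n)=\sum_{i=1}^n\delta(x_i,\hat x_i)$ for $x^n,\hat x^n\in\{0,1\}^n$. For $D\in\mathbb{R}$ let $$R(D)=\inf\{\,I(x^n;\hat x^n)\;:\;\mathbb{E}[d(x^n,\hat x^n)]\le D\,\}$$ be the rate-distortion function (in bits) of the source sequence $x^n$, where the infimum is over all conditional distributions (test channels) of $\hat x^n\in\{0,1\}^n$ given $x^n$, and $\inf\emptyset=+\infty$. Let $H(t)=-t\log_2 t-(1-t)\log_2(1-t)$ be the binary entropy function and $[t]^+=\max\{t,0\}$. For $\lambda\ge 0$ put $$\tilde D_i=\begin{cases}\lambda & \text{if }\lambda<\min\{p_i,1-p_i\},\\ \min\{p_i,1-p_i\}&\text{otherwise.}\end{cases}$$ **Theorem.** (a) A level $\lambda\ge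 0$ with $$\sum_{i=1}^n\tilde D_i=D+\sum_{i=1}^n p_i-n \qquad (*)$$ exists if and only if $\sum_i(1-p_i)\le D\le\sum_i(1-p_i)+\sum_i\min\{p_i,1-p_i\}$. (b) For every $D$ and every $\lambda\ge 0$ satisfying $(*)$, $$R(D)=\sum_{i=1}^n\bigl[H(p_i)-H(\tilde D_i)\bigr]^+ .$$ Moreover $R(D)$ is achieved by a test channel that acts on the $n$ components separately (as a product of channels $x_i\to\hat x_i$), has total expected distortion exactly $D$ and mutual information $R(D)$; its component distortions $D_i=\mathbb{E}[\delta(x_i,\hat x_i)]$ satisfy $\tilde D_i=D_i+p_i-1$, and, for every $i$ with $\tilde D_i\ne\frac12$, its test-channel input-probability distribution is $$q_{0,i}=\Pr(\hat x_i=0)=\frac{1-p_i-\tilde D_i}{1-2\tilde D_i},\qquad q_{1,i}=\Pr(\hat x_i=1)=\frac{p_i-\tilde D_i}{1-2\tilde D_i}.$$ (If $\tilde D_i=\frac12$, which forces $p_i=\frac12$, these quotients have the undefined form $0/0$ and nothing is claimed about the distribution of $\hat x_i$.) (c) $R(D)=+\infty$ if $D<\sum_i(1-p_i)$, and $R(D)=0$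 if $D>\sum_i(1-p_i)+\sum_i\min\{p_i,1-p_i\}$. -/

import Mathlib

open MeasureTheory ProbabilityTheory

noncomputable section

/-- A test channel `x → x̂` between finite alphabets: `Q x x̂ = Pr(x̂ | x)`. -/
structure TestChannel (A B : Type*) [Fintype B] where
  prob : A → B → ℝ
  nonneg : ∀ a b, 0 ≤ prob a b
  sum_eq_one : ∀ a, ∑ b, prob a b = 1

/-- The memoryless channel on words of length `n` whose `i`-th letter passes through `W i`. -/
def TestChannel.pi {n : ℕ} {A B : Type*} [Fintype B] (W : Fin n → TestChannel A B) :
    TestChannel (Fin n → A) (Fin n → B) where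
  prob x y := ∏ i, (W i).prob (x i) (y i)
  nonneg x y := Finset.prod_nonneg fun i _ => (W i).nonneg _ _
  sum_eq_one x := by
    classical
    rw [← Fintype.prod_sum (fun i b => (W i).prob (x i) b)]
    exact Finset.prod_eq_one fun i _ => (W i).sum_eq_one _

/-- `Pr(x̂ = b)` when the source letter has distribution `P` and is sent through `Q`. -/
def outputProb {A B : Type*} [Fintype A] [Fintype B] (P : A → ℝ) (Q : TestChannel A B)
    (b : B) : ℝ :=
  ∑ a, P a * Q.prob a b

/-- `E[d(x, x̂)]`. -/
def expectedDistortion {A B : Type*} [Fintype A] [Fintype B] (P : A → ℝ) (d : A → B → ℝ)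
    (Q : TestChannel A B) : ℝ :=
  ∑ a, ∑ b, P a * Q.prob a b * d a b

/-- Mutual information `I(x; x̂)` in bits.  A term with `P a * Q a b = 0` is zero, which is the
usual convention; in every other term the quotient is a quotient of positive numbers. -/
def mutualInformation {A B : Type*} [Fintype A] [Fintype B] (P : A → ℝ)
    (Q : TestChannel A B) : ℝ :=
  ∑ a, ∑ b, P a * Q.prob a b * Real.logb 2 (Q.prob a b / outputProb P Q b)

/-- The rate-distortion function of a source with distribution `P` on a finite alphabet: the
infimum of `I(x; x̂)` over all test channels with `E[d(x, x̂)] ≤ D` (`+∞` if there is none). -/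
def rateDistortion {A B : Type*} [Fintype A] [Fintype B] (P : A → ℝ) (d : A → B → ℝ)
    (D : ℝ) : EReal :=
  ⨅ Q : {Q : TestChannel A B // expectedDistortion P d Q ≤ D},
    ((mutualInformation P Q.1 : ℝ) : EReal)

/-- Binary entropy in bits. -/
def binaryEntropyBits (t : ℝ) : ℝ :=
  Real.binEntropy t / Real.log 2

/-- The letter-by-letter distortion; rows are indexed by `x`, columns by `x̂`. -/
def letterDistortion : Fin 2 → Fin 2 → ℝ :=
  !![1, 2;
     1, 0]

/-- The distortion between an error pattern and an erasure pattern. -/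
def patternDistortion {n : ℕ} (x y : Fin n → Fin 2) : ℝ :=
  ∑ i, letterDistortion (x i) (y i)

/-- Reverse water-filling at level `l` for a component with `Pr(x = 1) = p`. -/
def waterFill (l p : ℝ) : ℝ :=
  if l < min p (1 - p) then l else min p (1 - p)

/-- The distribution of a single random letter. -/
def letterLaw {Ω : Type*} [MeasurableSpace Ω] (μ : Measure Ω) (Y : Ω → Fin 2) :
    Fin 2 → ℝ :=
  fun a => μ.real {ω | Y ω = a}

/-- The joint distribution of the random word `(X 0, …, X (n - 1))`. -/
def wordLaw {Ω : Type*} [MeasurableSpace Ω] (μ : Measure Ω) {n : ℕ}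
    (X : Fin n → Ω → Fin 2) : (Fin n → Fin 2) → ℝ :=
  fun x => μ.real {ω | ∀ i, X i ω = x i}

end

/-! Up to `∑ i, Pr(x_i = 0)`, which no channel can change, the distortion is Hamming distortion
(`letterDistortion_eq`), so the claim is reverse water-filling for independent bits at Hamming level
`D + ∑ p_i - n`.

The converse is Lagrangian duality: if `∑ a, P a * exp (φ a b) ≤ 1` for every `b`, then `E φ` is at
most the mutual information in nats (`sum_le_log_two_mul_mutualInformation`). Take for `φ` the sum
over letters of `c_i(x_i) - L * Hamming`, with one slope `L = log ((1 - l) / l)` for all letters.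
The constraint then factors over letters, so arbitrary joint channels are covered without
single-letterization or convexity of the rate function. The `c_i` come from `exists_letter_dual`;
level `0` is reached as a right limit.

Achievability: `exists_letter_channel` meets the bound in each letter, and information adds over
product channels (`mutualInformation_pi`). -/

/-! ### Dual bound on mutual information -/

theorem TestChannel.sum_joint {A B : Type*} [Fintype A] [Fintype B] (P : A → ℝ)
    (Q : TestChannel A B) (f : A → ℝ) :
    ∑ a, ∑ b, P a * Q.prob a b * f a = ∑ a, P a * f a := by
  refine Finset.sum_congr rfl fun a _ => ?_
  rw [← Finset.sum_mul, ← Finset.mul_sum, Q.sum_eq_one, mul_one]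

theorem outputProb_nonneg {A B : Type*} [Fintype A] [Fintype B] {P : A → ℝ}
    (hP : ∀ a, 0 ≤ P a) (Q : TestChannel A B) (b : B) : 0 ≤ outputProb P Q b :=
  Finset.sum_nonneg fun a _ => mul_nonneg (hP a) (Q.nonneg a b)

theorem sum_outputProb {A B : Type*} [Fintype A] [Fintype B] (P : A → ℝ)
    (Q : TestChannel A B) : ∑ b, outputProb P Q b = ∑ a, P a := by
  unfold outputProb
  rw [Finset.sum_comm]
  simpa using Q.sum_joint P (fun _ => 1)

theorem outputProb_pos {A B : Type*} [Fintype A] [Fintype B] {P : A → ℝ}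
    (hP : ∀ a, 0 ≤ P a) (Q : TestChannel A B) {a : A} {b : B} (h : 0 < P a * Q.prob a b) :
    0 < outputProb P Q b :=
  h.trans_le (Finset.single_le_sum (f := fun a => P a * Q.prob a b)
    (fun a _ => mul_nonneg (hP a) (Q.nonneg a b)) (Finset.mem_univ a))

/-- The dual lower bound on mutual information. -/
theorem sum_le_log_two_mul_mutualInformation {A B : Type*} [Fintype A] [Fintype B] {P : A → ℝ}
    (hP : ∀ a, 0 ≤ P a) (Q : TestChannel A B) (φ : A → B → ℝ)
    (hφ : ∀ b, ∑ a, P a * Real.exp (φ a b) ≤ 1) (hP1 : ∑ a, P a = 1) :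
    ∑ a, ∑ b, P a * Q.prob a b * φ a b ≤ Real.log 2 * mutualInformation P Q := by
  have hlog2 : Real.log 2 ≠ 0 := (Real.log_pos one_lt_two).ne'
  -- Termwise `log t ≤ t - 1` at `t = q(b) * exp φ / Q(b|a)`, with `q` the output law; by `hφ` the
  -- correction sums to at most `0`. Where `P a * Q.prob a b = 0`, the correction is nonnegative,
  -- which suffices.
  have key : ∀ a b, P a * Q.prob a b * φ a b ≤
      Real.log 2 * (P a * Q.prob a b * Real.logb 2 (Q.prob a b / outputProb P Q b)) +
        (outputProb P Q b * (P a * Real.exp (φ a b)) - P a * Q.prob a b) := by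
    intro a b
    have hq := outputProb_nonneg hP Q b
    rcases (mul_nonneg (hP a) (Q.nonneg a b)).eq_or_lt with h | h
    · rw [← h]
      have := mul_nonneg hq (mul_nonneg (hP a) (Real.exp_pos (φ a b)).le)
      simpa using this
    · have hq' := outputProb_pos hP Q h
      have hQ : 0 < Q.prob a b := pos_of_mul_pos_right h (hP a)
      have e1 : Real.log 2 * (P a * Q.prob a b * Real.logb 2 (Q.prob a b / outputProb P Q b)) =
          P a * Q.prob a b * Real.log (Q.prob a b / outputProb P Q b) := by
        rw [Real.logb]; field_simp
      have h1 := Real.log_le_sub_one_of_pos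
        (show 0 < outputProb P Q b * Real.exp (φ a b) / Q.prob a b by positivity)
      rw [Real.log_div (by positivity) hQ.ne', Real.log_mul hq'.ne' (Real.exp_pos _).ne',
        Real.log_exp] at h1
      rw [e1, Real.log_div hQ.ne' hq'.ne']
      have h2 := mul_le_mul_of_nonneg_left h1 h.le
      have e2 : P a * Q.prob a b * (outputProb P Q b * Real.exp (φ a b) / Q.prob a b - 1) =
          outputProb P Q b * (P a * Real.exp (φ a b)) - P a * Q.prob a b := by
        field_simp
      rw [e2] at h2
      linarith
  have hsum := Finset.sum_le_sum fun a (_ : a ∈ Finset.univ) =>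
    Finset.sum_le_sum fun b (_ : b ∈ Finset.univ) => key a b
  simp only [Finset.sum_add_distrib, Finset.sum_sub_distrib, ← Finset.mul_sum] at hsum
  have h3 : ∑ a, ∑ b, outputProb P Q b * (P a * Real.exp (φ a b)) ≤ 1 := by
    rw [Finset.sum_comm]
    calc _ = ∑ b, outputProb P Q b * ∑ a, P a * Real.exp (φ a b) := by
          simp only [Finset.mul_sum]
      _ ≤ ∑ b, outputProb P Q b * 1 := Finset.sum_le_sum fun b _ =>
          mul_le_mul_of_nonneg_left (hφ b) (outputProb_nonneg hP Q b)
      _ = 1 := by simp [sum_outputProb, hP1]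
  have h4 : ∑ a, P a * ∑ b, Q.prob a b = 1 := by simp [Q.sum_eq_one, hP1]
  rw [h4] at hsum
  unfold mutualInformation
  linarith

theorem mutualInformation_nonneg {A B : Type*} [Fintype A] [Fintype B] {P : A → ℝ}
    (hP : ∀ a, 0 ≤ P a) (hP1 : ∑ a, P a = 1) (Q : TestChannel A B) :
    0 ≤ mutualInformation P Q := by
  have h := sum_le_log_two_mul_mutualInformation hP Q (fun _ _ => 0) (by simp [hP1]) hP1
  simp only [mul_zero, Finset.sum_const_zero] at h
  exact nonneg_of_mul_nonneg_right h (Real.log_pos one_lt_two)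

/-! ### Product sources and memoryless channels -/

/-- A sum against a product weight of a function of one coordinate. -/
theorem sum_prod_mul_coord {ι A : Type*} [Fintype ι] [DecidableEq ι] [Fintype A]
    (P : ι → A → ℝ) (hP : ∀ i, ∑ a, P i a = 1) (i : ι) (f : A → ℝ) :
    ∑ x : ι → A, (∏ j, P j (x j)) * f (x i) = ∑ a, P i a * f a := by
  have h : ∀ x : ι → A, (∏ j, P j (x j)) * f (x i) =
      ∏ j, P j (x j) * (if j = i then f (x j) else 1) := by
    intro x
    rw [Finset.prod_mul_distrib, Finset.prod_ite_eq' Finset.univ i (fun j => f (x j))]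
    simp
  simp_rw [h]
  rw [← Fintype.prod_sum (fun j a => P j a * (if j = i then f a else 1)),
    Finset.prod_eq_single i]
  · simp
  · intro j _ hj
    simp [hj, hP]
  · simp

theorem sum_prod_eq_one {ι A : Type*} [Fintype ι] [DecidableEq ι] [Fintype A]
    (P : ι → A → ℝ) (hP : ∀ i, ∑ a, P i a = 1) : ∑ x : ι → A, ∏ j, P j (x j) = 1 := by
  rw [← Fintype.prod_sum]
  exact Finset.prod_eq_one fun i _ => hP i

theorem TestChannel.sum_pi_coord {n : ℕ} {A B : Type*} [Fintype A] [Fintype B]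
    (P : Fin n → A → ℝ) (hP : ∀ i, ∑ a, P i a = 1) (W : Fin n → TestChannel A B)
    (i : Fin n) (f : A → B → ℝ) :
    ∑ x, ∑ y, (∏ j, P j (x j)) * (TestChannel.pi W).prob x y * f (x i) (y i) =
      ∑ a, ∑ b, P i a * (W i).prob a b * f a b := by
  have h : ∀ x : Fin n → A,
      ∑ y, (∏ j, P j (x j)) * (TestChannel.pi W).prob x y * f (x i) (y i) =
      (∏ j, P j (x j)) * ∑ b, (W i).prob (x i) b * f (x i) b := by
    intro x
    simp_rw [mul_assoc]
    rw [← Finset.mul_sum]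
    congr 1
    exact sum_prod_mul_coord (fun j => (W j).prob (x j)) (fun j => (W j).sum_eq_one _) i (f (x i))
  simp_rw [h]
  rw [sum_prod_mul_coord P hP i (fun a => ∑ b, (W i).prob a b * f a b)]
  simp_rw [Finset.mul_sum, mul_assoc]

theorem outputProb_pi {n : ℕ} {A B : Type*} [Fintype A] [Fintype B]
    (P : Fin n → A → ℝ) (W : Fin n → TestChannel A B) (y : Fin n → B) :
    outputProb (fun x => ∏ i, P i (x i)) (TestChannel.pi W) y = ∏ i, outputProb (P i) (W i) (y i) := by
  unfold outputProb TestChannel.pi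
  rw [Fintype.prod_sum]
  simp_rw [Finset.prod_mul_distrib]

theorem mutualInformation_pi {n : ℕ} {A B : Type*} [Fintype A] [Fintype B]
    (P : Fin n → A → ℝ) (hP0 : ∀ i a, 0 ≤ P i a) (hP : ∀ i, ∑ a, P i a = 1)
    (W : Fin n → TestChannel A B) :
    mutualInformation (fun x => ∏ i, P i (x i)) (TestChannel.pi W) =
      ∑ i, mutualInformation (P i) (W i) := by
  have h : ∀ x y, (∏ i, P i (x i)) * (TestChannel.pi W).prob x y *
      Real.logb 2 ((TestChannel.pi W).prob x y /
        outputProb (fun x => ∏ i, P i (x i)) (TestChannel.pi W) y) =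
      ∑ i, (∏ j, P j (x j)) * (TestChannel.pi W).prob x y *
        Real.logb 2 ((W i).prob (x i) (y i) / outputProb (P i) (W i) (y i)) := by
    intro x y
    rw [← Finset.mul_sum]
    -- The logarithm of the product splits only when every factor is nonzero; otherwise the weight
    -- kills both sides.
    by_cases h0 : (∏ i, P i (x i)) * (TestChannel.pi W).prob x y = 0
    · simp [h0]
    congr 1
    rw [outputProb_pi]
    have h1 : (TestChannel.pi W).prob x y = ∏ i, (W i).prob (x i) (y i) := rfl
    rw [h1] at h0 ⊢
    rw [← Finset.prod_mul_distrib, ← ne_eq, Finset.prod_ne_zero_iff] at h0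
    rw [← Finset.prod_div_distrib, Real.logb_prod]
    intro i _
    have h2 := h0 i (Finset.mem_univ i)
    have h3 : 0 < P i (x i) * (W i).prob (x i) (y i) :=
      lt_of_le_of_ne (mul_nonneg (hP0 _ _) ((W i).nonneg _ _)) h2.symm
    exact div_ne_zero (right_ne_zero_of_mul h2) (outputProb_pos (hP0 i) (W i) h3).ne'
  unfold mutualInformation at *
  simp_rw [h]
  simp_rw [fun x : Fin n → A => Finset.sum_comm (s := (Finset.univ : Finset (Fin n → B)))
    (t := (Finset.univ : Finset (Fin n)))
    (f := fun y i => (∏ j, P j (x j)) * (TestChannel.pi W).prob x y *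
        Real.logb 2 ((W i).prob (x i) (y i) / outputProb (P i) (W i) (y i)))]
  rw [Finset.sum_comm]
  exact Finset.sum_congr rfl fun i _ => TestChannel.sum_pi_coord P hP W i
    (fun a b => Real.logb 2 ((W i).prob a b / outputProb (P i) (W i) b))

/-! ### Reduction to Hamming distortion -/

/-- The Hamming distortion between letters. -/
def letterHamming (a b : Fin 2) : ℝ := if a = b then 0 else 1

theorem letterHamming_nonneg (a b : Fin 2) : 0 ≤ letterHamming a b := by
  unfold letterHamming; split_ifs <;> norm_num

/-- The first summand depends on the source letter alone, so its expectation is the same for all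
channels and merely shifts `D`. -/
theorem letterDistortion_eq (a b : Fin 2) :
    letterDistortion a b = letterHamming a 1 + letterHamming a b := by
  fin_cases a <;> fin_cases b <;> norm_num [letterDistortion, letterHamming]

/-- The expected Hamming distortion of a word is `E[d]` up to a constant of the source. -/
theorem expectedDistortion_patternDistortion {n : ℕ} (P : Fin n → Fin 2 → ℝ)
    (hP : ∀ i, ∑ a, P i a = 1) (Q : TestChannel (Fin n → Fin 2) (Fin n → Fin 2)) :
    expectedDistortion (fun x => ∏ i, P i (x i)) patternDistortion Q =
      ∑ i, P i 0 + ∑ x, ∑ y, (∏ i, P i (x i)) * Q.prob x y * ∑ i, letterHamming (x i) (y i) := by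
  unfold expectedDistortion patternDistortion
  simp_rw [letterDistortion_eq, Finset.sum_add_distrib, mul_add, Finset.sum_add_distrib]
  congr 1
  rw [Q.sum_joint (fun x => ∏ i, P i (x i)) (fun x => ∑ i, letterHamming (x i) 1)]
  simp_rw [Finset.mul_sum]
  rw [Finset.sum_comm]
  refine Finset.sum_congr rfl fun i _ => ?_
  rw [sum_prod_mul_coord P hP i (fun a => letterHamming a 1)]
  simp [letterHamming]

theorem expectedDistortion_letterDistortion (P : Fin 2 → ℝ) (W : TestChannel (Fin 2) (Fin 2)) :
    expectedDistortion P letterDistortion W =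
      P 0 + expectedDistortion P letterHamming W := by
  unfold expectedDistortion
  simp_rw [letterDistortion_eq, mul_add, Finset.sum_add_distrib]
  rw [W.sum_joint P (fun a => letterHamming a 1)]
  simp [letterHamming]

theorem expectedDistortion_pi {n : ℕ} (P : Fin n → Fin 2 → ℝ)
    (hP : ∀ i, ∑ a, P i a = 1) (W : Fin n → TestChannel (Fin 2) (Fin 2)) :
    expectedDistortion (fun x => ∏ i, P i (x i)) patternDistortion (TestChannel.pi W) =
      ∑ i, P i 0 + ∑ i, expectedDistortion (P i) letterHamming (W i) := by
  rw [expectedDistortion_patternDistortion P hP]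
  congr 1
  simp_rw [Finset.mul_sum]
  simp_rw [fun x : Fin n → Fin 2 => Finset.sum_comm
    (s := (Finset.univ : Finset (Fin n → Fin 2))) (t := (Finset.univ : Finset (Fin n)))
    (f := fun y i => (∏ j, P j (x j)) * (TestChannel.pi W).prob x y * letterHamming (x i) (y i))]
  rw [Finset.sum_comm]
  exact Finset.sum_congr rfl fun i _ => TestChannel.sum_pi_coord P hP W i letterHamming

/-! ### Water-filling and the converse -/

theorem waterFill_eq_min (l p : ℝ) : waterFill l p = min l (min p (1 - p)) := by
  unfold waterFill
  split_ifs with h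
  · exact (min_eq_left h.le).symm
  · exact (min_eq_right (not_lt.1 h)).symm

theorem min_one_sub_le_half (p : ℝ) : min p (1 - p) ≤ 1 / 2 := by
  rcases min_choice p (1 - p) with h | h <;> rw [h]
  · have := min_le_right p (1 - p); linarith
  · have := min_le_left p (1 - p); linarith

theorem binEntropy_min (p : ℝ) : Real.binEntropy (min p (1 - p)) = Real.binEntropy p := by
  rcases min_choice p (1 - p) with h | h <;> rw [h]
  exact Real.binEntropy_one_sub p

/-- The dual variable of a single letter. -/
theorem exists_letter_dual {l p : ℝ} (hl : 0 < l) (hl2 : l ≤ 1 / 2) (hp0 : 0 ≤ p) (hp1 : p ≤ 1)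
    (P : Fin 2 → ℝ) (hP0 : P 0 = 1 - p) (hP1 : P 1 = p) :
    ∃ c : Fin 2 → ℝ,
      ∑ a, P a * c a = Real.binEntropy p - Real.binEntropy (waterFill l p) +
        waterFill l p * Real.log ((1 - l) / l) ∧
      ∀ b, ∑ a, P a * Real.exp (c a - letterHamming a b * Real.log ((1 - l) / l)) ≤ 1 := by
  have hl' : 0 < 1 - l := by linarith
  have hr : 0 < (1 - l) / l := by positivity
  by_cases h : l < min p (1 - p)
  · have hlp : l < p := h.trans_le (min_le_left _ _)
    have hlq : l < 1 - p := h.trans_le (min_le_right _ _)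
    have hp : 0 < p := hl.trans hlp
    have hq : 0 < 1 - p := hl.trans hlq
    have hw : waterFill l p = l := by unfold waterFill; rw [if_pos h]
    -- This cancels `P a` in the constraint: the terms become `1 - l` and `l`, so equality holds for
    -- both `b`.
    refine ⟨fun a => Real.log (1 - l) - Real.log (P a), ?_, fun b => ?_⟩
    · rw [hw, Real.log_div hl'.ne' hl.ne']
      simp only [Real.binEntropy, Real.log_inv, Fin.sum_univ_two, hP0, hP1]
      ring
    · have hPpos : ∀ a, 0 < P a := by
        intro a; fin_cases a <;> simp [hP0, hP1, hp] ; linarith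
      have e : ∀ a, P a * Real.exp (Real.log (1 - l) - Real.log (P a) -
          letterHamming a b * Real.log ((1 - l) / l)) = if a = b then 1 - l else l := by
        intro a
        have := hPpos a
        unfold letterHamming
        split_ifs
        · rw [zero_mul, sub_zero, Real.exp_sub, Real.exp_log hl', Real.exp_log this]
          field_simp
        · rw [one_mul, Real.exp_sub, Real.exp_sub, Real.exp_log hl', Real.exp_log this,
            Real.exp_log hr]
          field_simp
      simp_rw [e]
      fin_cases b <;> simp
  · have hm : min p (1 - p) ≤ l := not_lt.1 h
    have hw : waterFill l p = min p (1 - p) := by unfold waterFill; rw [if_neg h]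
    rw [hw, binEntropy_min, sub_self, zero_add]
    -- After clearing denominators this is `(l - m) * (1 - 2 * l) ≥ 0`.
    have main : ∀ m : ℝ, 0 ≤ m → m ≤ l →
        m * ((1 - l) / l) + (1 - m) * ((1 - l) / l)⁻¹ ≤ 1 := by
      intro m hm0 hml
      rw [inv_div, mul_div_assoc', mul_div_assoc', div_add_div _ _ hl.ne' hl'.ne',
        div_le_one (by positivity)]
      nlinarith [mul_nonneg (sub_nonneg.2 hml) (show (0:ℝ) ≤ 1 - 2 * l by linarith)]
    rcases le_total p (1 - p) with hle | hle
    · rw [min_eq_left hle] at hm ⊢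
      -- At saturation the constant output `0` is optimal: the constraint is tight at `b = 0`, and
      -- at `b = 1` it is `main`.
      refine ⟨fun a => letterHamming a 0 * Real.log ((1 - l) / l), ?_, fun b => ?_⟩
      · simp [letterHamming, hP1]
      · have := main p hp0 hm
        fin_cases b <;>
          simp [letterHamming, hP0, hP1, Real.exp_neg, Real.exp_log hr] at this ⊢
        linarith
    · rw [min_eq_right hle] at hm ⊢
      refine ⟨fun a => letterHamming a 1 * Real.log ((1 - l) / l), ?_, fun b => ?_⟩
      · simp [letterHamming, hP0]
      · have := main (1 - p) (by linarith) hm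
        fin_cases b <;>
          simp [letterHamming, hP0, hP1, Real.exp_neg, Real.exp_log hr] at this ⊢
        linarith

/-- The converse for a positive water level, in nats. -/
theorem converse_of_pos {n : ℕ} (P : Fin n → Fin 2 → ℝ) (p : Fin n → ℝ)
    (hp0 : ∀ i, 0 ≤ p i) (hp1 : ∀ i, p i ≤ 1)
    (hP0 : ∀ i, P i 0 = 1 - p i) (hP1 : ∀ i, P i 1 = p i)
    (Q : TestChannel (Fin n → Fin 2) (Fin n → Fin 2)) {l : ℝ} (hl : 0 < l) (hl2 : l ≤ 1 / 2)
    (hQ : ∑ x, ∑ y, (∏ i, P i (x i)) * Q.prob x y * ∑ i, letterHamming (x i) (y i) ≤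
      ∑ i, waterFill l (p i)) :
    ∑ i, (Real.binEntropy (p i) - Real.binEntropy (waterFill l (p i))) ≤
      Real.log 2 * mutualInformation (fun x => ∏ i, P i (x i)) Q := by
  have hPn : ∀ i a, 0 ≤ P i a := by
    intro i a; fin_cases a <;> simp [hP0, hP1, hp0, hp1]
  have hPs : ∀ i, ∑ a, P i a = 1 := by intro i; simp [hP0, hP1]
  choose c hc1 hc2 using fun i => exists_letter_dual hl hl2 (hp0 i) (hp1 i) (P i) (hP0 i) (hP1 i)
  set L := Real.log ((1 - l) / l) with hL
  have hL0 : 0 ≤ L := Real.log_nonneg (by rw [le_div_iff₀ hl]; linarith)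
  have h := sum_le_log_two_mul_mutualInformation (P := fun x => ∏ i, P i (x i))
    (fun x => Finset.prod_nonneg fun i _ => hPn _ _) Q
    -- The exponential of a sum is a product, so the constraint at `y` is a product of letter
    -- constraints, each at most `1`.
    (fun x y => ∑ i, (c i (x i) - letterHamming (x i) (y i) * L)) (fun y => by
      simp_rw [Real.exp_sum, ← Finset.prod_mul_distrib]
      rw [← Fintype.prod_sum
        (fun i a => P i a * Real.exp (c i a - letterHamming a (y i) * L))]
      exact Finset.prod_le_one
        (fun i _ => Finset.sum_nonneg fun a _ => mul_nonneg (hPn i a) (Real.exp_pos _).le)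
        (fun i _ => hc2 i (y i))) (sum_prod_eq_one P hPs)
  refine le_trans ?_ h
  have e1 : ∑ x, ∑ y, (∏ i, P i (x i)) * Q.prob x y * ∑ i, c i (x i) = ∑ i, ∑ a, P i a * c i a := by
    rw [Q.sum_joint (fun x => ∏ i, P i (x i)) (fun x => ∑ i, c i (x i))]
    simp_rw [Finset.mul_sum]
    rw [Finset.sum_comm]
    exact Finset.sum_congr rfl fun i _ => sum_prod_mul_coord P hPs i (c i)
  simp_rw [Finset.sum_sub_distrib, ← Finset.sum_mul, mul_sub, Finset.sum_sub_distrib, e1, hc1,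
    ← mul_assoc, ← Finset.sum_mul, Finset.sum_add_distrib, ← Finset.sum_mul,
    Finset.sum_sub_distrib]
  nlinarith [mul_le_mul_of_nonneg_right hQ hL0]

/-- Levels above `1 / 2` change nothing, so the converse may assume `l ≤ 1 / 2`, where the slope is
nonnegative. -/
theorem waterFill_min_half (l p : ℝ) : waterFill (min l (1 / 2)) p = waterFill l p := by
  rw [waterFill_eq_min, waterFill_eq_min, min_assoc, min_eq_right (min_one_sub_le_half p)]

theorem continuous_waterFill (p : ℝ) : Continuous fun l => waterFill l p := by
  simp_rw [waterFill_eq_min]; fun_prop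

theorem converse {n : ℕ} (P : Fin n → Fin 2 → ℝ) (p : Fin n → ℝ)
    (hp0 : ∀ i, 0 ≤ p i) (hp1 : ∀ i, p i ≤ 1)
    (hP0 : ∀ i, P i 0 = 1 - p i) (hP1 : ∀ i, P i 1 = p i)
    (Q : TestChannel (Fin n → Fin 2) (Fin n → Fin 2)) {l : ℝ} (hl : 0 ≤ l)
    (hQ : ∑ x, ∑ y, (∏ i, P i (x i)) * Q.prob x y * ∑ i, letterHamming (x i) (y i) ≤
      ∑ i, waterFill l (p i)) :
    ∑ i, (Real.binEntropy (p i) - Real.binEntropy (waterFill l (p i))) ≤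
      Real.log 2 * mutualInformation (fun x => ∏ i, P i (x i)) Q := by
  have hcont : Continuous fun t => ∑ i, (Real.binEntropy (p i) -
      Real.binEntropy (waterFill t (p i))) :=
    continuous_finsetSum _ fun i _ => continuous_const.sub
      (Real.binEntropy_continuous.comp (continuous_waterFill (p i)))
  -- The slope blows up at `l = 0`. Approaching from the right keeps the level positive, and raising
  -- it only relaxes `hQ`.
  refine le_of_tendsto (x := nhdsWithin l (Set.Ioi l))
    ((hcont.tendsto l).mono_left nhdsWithin_le_nhds) ?_
  filter_upwards [self_mem_nhdsWithin] with t (ht : l < t)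
  have ht0 : 0 < min t (1 / 2) := lt_min (hl.trans_lt ht) (by norm_num)
  have := converse_of_pos P p hp0 hp1 hP0 hP1 Q ht0 (min_le_right _ _) (hQ.trans (by
    simp_rw [waterFill_min_half, waterFill_eq_min]
    exact Finset.sum_le_sum fun i _ => min_le_min_right _ ht.le))
  simpa only [waterFill_min_half] using this

/-! ### Achievability by single-letter channels -/

/-- The channel that ignores its input. -/
def TestChannel.const {A B : Type*} [Fintype B] [DecidableEq B] (b₀ : B) : TestChannel A B where
  prob _ b := if b = b₀ then 1 else 0
  nonneg _ b := by split_ifs <;> norm_num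
  sum_eq_one _ := by simp

theorem outputProb_const {A B : Type*} [Fintype A] [Fintype B] [DecidableEq B] {P : A → ℝ}
    (hP : ∑ a, P a = 1) (b₀ b : B) :
    outputProb P (TestChannel.const b₀) b = if b = b₀ then 1 else 0 := by
  simp only [outputProb, TestChannel.const, ← Finset.sum_mul, hP, one_mul]

theorem mutualInformation_const {A B : Type*} [Fintype A] [Fintype B] [DecidableEq B] {P : A → ℝ}
    (hP : ∑ a, P a = 1) (b₀ : B) : mutualInformation P (TestChannel.const b₀) = 0 := by
  unfold mutualInformation
  simp_rw [outputProb_const hP]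
  refine Finset.sum_eq_zero fun a _ => Finset.sum_eq_zero fun b _ => ?_
  by_cases h : b = b₀ <;> simp [TestChannel.const, h]

/-- The optimal single-letter channel: a backward binary symmetric channel below saturation,
a constant channel at saturation. -/
theorem exists_letter_channel {l p : ℝ} (hl : 0 ≤ l) (P : Fin 2 → ℝ)
    (hP0 : P 0 = 1 - p) (hP1 : P 1 = p) :
    ∃ W : TestChannel (Fin 2) (Fin 2),
      expectedDistortion P letterHamming W = waterFill l p ∧
      mutualInformation P W = binaryEntropyBits p - binaryEntropyBits (waterFill l p) ∧
      (waterFill l p ≠ 1 / 2 →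
        outputProb P W 0 = (1 - p - waterFill l p) / (1 - 2 * waterFill l p) ∧
        outputProb P W 1 = (p - waterFill l p) / (1 - 2 * waterFill l p)) := by
  have hPs : ∑ a, P a = 1 := by simp [hP0, hP1]
  by_cases h : l < min p (1 - p)
  · have hlp : l < p := h.trans_le (min_le_left _ _)
    have hlq : l < 1 - p := h.trans_le (min_le_right _ _)
    have hp : 0 < p := hl.trans_lt hlp
    have hq : 0 < 1 - p := hl.trans_lt hlq
    have h2 : 0 < 1 - 2 * l := by linarith
    have h2' : 1 - 2 * l ≠ 0 := h2.ne'
    have hw : waterFill l p = l := by unfold waterFill; rw [if_pos h]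
    -- `q` is the input law that a binary symmetric channel with crossover `l` maps to `P`; `W`
    -- below is its Bayes inverse.
    obtain ⟨q, hq0, hq1⟩ : ∃ q : Fin 2 → ℝ, q 0 = (1 - p - l) / (1 - 2 * l) ∧
        q 1 = (p - l) / (1 - 2 * l) :=
      ⟨![(1 - p - l) / (1 - 2 * l), (p - l) / (1 - 2 * l)], rfl, rfl⟩
    have hq0' : 0 < q 0 := by rw [hq0]; exact div_pos (by linarith) h2
    have hq1' : 0 < q 1 := by rw [hq1]; exact div_pos (by linarith) h2
    have hm0 := (eq_div_iff h2').1 hq0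
    have hm1 := (eq_div_iff h2').1 hq1
    have hsum : q 0 + q 1 = 1 := mul_right_cancel₀ h2' (by linear_combination hm0 + hm1)
    have hback0 : q 0 * (1 - l) + q 1 * l = 1 - p :=
      mul_right_cancel₀ h2' (by linear_combination (1 - l) * hm0 + l * hm1)
    have hback1 : q 0 * l + q 1 * (1 - l) = p :=
      mul_right_cancel₀ h2' (by linear_combination l * hm0 + (1 - l) * hm1)
    rw [hw]
    let W : TestChannel (Fin 2) (Fin 2) :=
      { prob := fun a b => q b * (if a = b then 1 - l else l) / P a
        nonneg := by
          intro a b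
          have h1 : 0 ≤ 1 - l := by linarith
          fin_cases a <;> fin_cases b <;> simp [hP0, hP1] <;> positivity
        sum_eq_one := by
          intro a
          fin_cases a
          · simp [Fin.sum_univ_two, hP0, ← add_div, hback0, hq.ne']
          · simp [Fin.sum_univ_two, hP1, ← add_div, hback1, hp.ne'] }
    have hPpos : ∀ a, 0 < P a := by
      intro a; fin_cases a <;> simp [hP0, hP1, hp]; linarith
    have hqpos : ∀ a, 0 < q a := by
      intro a; fin_cases a <;> simp [hq0', hq1']
    have hj : ∀ a b, P a * W.prob a b = q b * (if a = b then 1 - l else l) := by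
      intro a b
      have := (hPpos a).ne'
      simp only [W]; field_simp
    have ho : ∀ b, outputProb P W b = q b := by
      intro b
      simp only [outputProb, hj, ← Finset.mul_sum]
      fin_cases b <;> simp [Fin.sum_univ_two]
    refine ⟨W, ?_, ?_, fun _ => ⟨by rw [ho, hq0], by rw [ho, hq1]⟩⟩
    · simp only [expectedDistortion, hj, letterHamming, Fin.sum_univ_two]
      simp
      linear_combination l * hsum
    · have hterm : ∀ a b, P a * W.prob a b * Real.logb 2 (W.prob a b / outputProb P W b) =
          q b * ((if a = b then 1 - l else l) * (Real.log (if a = b then 1 - l else l)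
            - Real.log (P a))) / Real.log 2 := by
        intro a b
        have h1 := (hPpos a).ne'
        have h2 := (hqpos b).ne'
        rw [ho, hj]
        -- At `l = 0` the off-diagonal weights vanish and the logarithm cannot be split.
        rcases eq_or_ne (if a = b then 1 - l else l) 0 with h0 | h0
        · simp [h0]
        · have : W.prob a b / q b = (if a = b then 1 - l else l) / P a := by
            simp only [W]; field_simp
          rw [this, Real.logb, Real.log_div h0 h1]
          ring
      simp only [mutualInformation, hterm, ← Finset.sum_div, binaryEntropyBits, ← sub_div]
      congr 1
      simp only [Fin.sum_univ_two, Real.binEntropy, Real.log_inv, hP0, hP1]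
      simp
      linear_combination (l * Real.log l + (1 - l) * Real.log (1 - l)) * hsum
        - Real.log (1 - p) * hback0 - Real.log p * hback1
  · have hw : waterFill l p = min p (1 - p) := by unfold waterFill; rw [if_neg h]
    have hH : binaryEntropyBits p - binaryEntropyBits (min p (1 - p)) = 0 := by
      simp [binaryEntropyBits, binEntropy_min]
    rw [hw, hH]
    rcases le_total p (1 - p) with hle | hle
    · rw [min_eq_left hle]
      refine ⟨TestChannel.const 0, ?_, mutualInformation_const hPs 0, fun hne => ?_⟩
      · simp [expectedDistortion, TestChannel.const, letterHamming, Fin.sum_univ_two, hP1]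
      · rw [outputProb_const hPs, outputProb_const hPs]
        have : 1 - 2 * p ≠ 0 := fun h0 => hne (by linarith)
        constructor
        · rw [if_pos rfl, eq_div_iff this]; ring
        · simp
    · rw [min_eq_right hle]
      refine ⟨TestChannel.const 1, ?_, mutualInformation_const hPs 1, fun hne => ?_⟩
      · simp [expectedDistortion, TestChannel.const, letterHamming, Fin.sum_univ_two, hP0]
      · rw [outputProb_const hPs, outputProb_const hPs]
        have : 1 - 2 * (1 - p) ≠ 0 := fun h0 => hne (by linarith)
        constructor
        · simp
        · rw [if_pos rfl, eq_div_iff this]; ring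

/-! ### Range of the water level and assembly -/

/-- Entropy is symmetric and increasing on `[0, 1/2]`. Hence the positive part in the rate formula
never truncates. -/
theorem binaryEntropyBits_waterFill_le {l p : ℝ} (hl : 0 ≤ l) (hp0 : 0 ≤ p) (hp1 : p ≤ 1) :
    binaryEntropyBits (waterFill l p) ≤ binaryEntropyBits p := by
  unfold binaryEntropyBits
  refine div_le_div_of_nonneg_right ?_ (Real.log_pos one_lt_two).le
  have hm : 0 ≤ min p (1 - p) := le_min hp0 (by linarith)
  have hm2 := min_one_sub_le_half p
  rw [← binEntropy_min p, waterFill_eq_min]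
  norm_num at hm2
  exact Real.binEntropy_strictMonoOn.monotoneOn
    ⟨le_min hl hm, (min_le_right _ _).trans (by simpa using hm2)⟩
    ⟨hm, by simpa using hm2⟩ (min_le_right _ _)

theorem exists_waterFill_sum_eq_iff {n : ℕ} (p : Fin n → ℝ) (hp0 : ∀ i, 0 ≤ p i)
    (hp1 : ∀ i, p i ≤ 1) (s : ℝ) :
    (∃ l : ℝ, 0 ≤ l ∧ ∑ i, waterFill l (p i) = s) ↔
      0 ≤ s ∧ s ≤ ∑ i, min (p i) (1 - p i) := by
  have hm : ∀ i, 0 ≤ min (p i) (1 - p i) := fun i => le_min (hp0 i) (by linarith [hp1 i])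
  simp_rw [waterFill_eq_min]
  constructor
  · rintro ⟨l, hl, rfl⟩
    exact ⟨Finset.sum_nonneg fun i _ => le_min hl (hm i),
      Finset.sum_le_sum fun i _ => min_le_right _ _⟩
  · rintro ⟨h0, h1⟩
    have hc : Continuous fun l : ℝ => ∑ i, min l (min (p i) (1 - p i)) := by fun_prop
    -- At level `1 / 2` every component is saturated, so `[0, 1/2]` already sweeps out all
    -- attainable sums.
    obtain ⟨l, hl, h⟩ := intermediate_value_Icc (show (0 : ℝ) ≤ 1 / 2 by norm_num)
      hc.continuousOn (show s ∈ Set.Icc _ _ by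
        constructor
        · simpa [min_eq_left (hm _)] using h0
        · simpa only [min_eq_right (min_one_sub_le_half _)] using h1)
    exact ⟨l, hl.1, h⟩

/-- The only place where independence enters. -/
theorem wordLaw_eq_prod {Ω : Type*} [MeasurableSpace Ω] (μ : Measure Ω) {n : ℕ}
    (X : Fin n → Ω → Fin 2) (hindep : iIndepFun X μ) :
    wordLaw μ X = fun x => ∏ i, letterLaw μ (X i) (x i) := by
  funext x
  have h := hindep.measure_inter_preimage_eq_mul Finset.univ (sets := fun i => {x i})
    (fun i _ => MeasurableSet.singleton _)
  unfold wordLaw letterLaw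
  simp only [Measure.real, ← ENNReal.toReal_prod]
  congr 1
  convert h using 2
  · ext ω; simp
  · rfl

theorem rateDistortion_le {A B : Type*} [Fintype A] [Fintype B] {P : A → ℝ} {d : A → B → ℝ}
    {D : ℝ} (Q : TestChannel A B) (hQ : expectedDistortion P d Q ≤ D) :
    rateDistortion P d D ≤ ((mutualInformation P Q : ℝ) : EReal) :=
  iInf_le (fun Q : {Q : TestChannel A B // expectedDistortion P d Q ≤ D} =>
    ((mutualInformation P Q.1 : ℝ) : EReal)) ⟨Q, hQ⟩

theorem le_rateDistortion {A B : Type*} [Fintype A] [Fintype B] {P : A → ℝ} {d : A → B → ℝ}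
    {D R : ℝ} (h : ∀ Q : TestChannel A B, expectedDistortion P d Q ≤ D →
      R ≤ mutualInformation P Q) : (R : EReal) ≤ rateDistortion P d D :=
  le_iInf fun Q => EReal.coe_le_coe_iff.2 (h Q.1 Q.2)

theorem rateDistortion_eq_top {A B : Type*} [Fintype A] [Fintype B] {P : A → ℝ} {d : A → B → ℝ}
    {D : ℝ} (h : ∀ Q : TestChannel A B, D < expectedDistortion P d Q) :
    rateDistortion P d D = ⊤ :=
  iInf_eq_top.2 fun Q => absurd Q.2 (not_le.2 (h Q.1))

theorem rateDistortion_pattern {n : ℕ} (P : Fin n → Fin 2 → ℝ) (p : Fin n → ℝ)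
    (hp0 : ∀ i, 0 ≤ p i) (hp1 : ∀ i, p i ≤ 1)
    (hP0 : ∀ i, P i 0 = 1 - p i) (hP1 : ∀ i, P i 1 = p i) {D l : ℝ} (hl : 0 ≤ l)
    (hD : ∑ i, waterFill l (p i) = D + ∑ i, p i - n) (W : Fin n → TestChannel (Fin 2) (Fin 2))
    (hW1 : ∀ i, expectedDistortion (P i) letterHamming (W i) = waterFill l (p i))
    (hW2 : ∀ i, mutualInformation (P i) (W i) =
      binaryEntropyBits (p i) - binaryEntropyBits (waterFill l (p i))) :
    expectedDistortion (fun x => ∏ i, P i (x i)) patternDistortion (TestChannel.pi W) = D ∧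
    mutualInformation (fun x => ∏ i, P i (x i)) (TestChannel.pi W) =
      ∑ i, max (binaryEntropyBits (p i) - binaryEntropyBits (waterFill l (p i))) 0 ∧
    rateDistortion (fun x => ∏ i, P i (x i)) patternDistortion D =
      ((∑ i, max (binaryEntropyBits (p i) - binaryEntropyBits (waterFill l (p i))) 0 : ℝ) :
        EReal) := by
  have hPn : ∀ i a, 0 ≤ P i a := by
    intro i a; fin_cases a <;> simp [hP0, hP1, hp0, hp1]
  have hPs : ∀ i, ∑ a, P i a = 1 := by intro i; simp [hP0, hP1]
  have hsum0 : ∑ i, P i 0 = n - ∑ i, p i := by simp [hP0]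
  have hmax : ∀ i, max (binaryEntropyBits (p i) - binaryEntropyBits (waterFill l (p i))) 0 =
      binaryEntropyBits (p i) - binaryEntropyBits (waterFill l (p i)) := fun i =>
    max_eq_left (sub_nonneg.2 (binaryEntropyBits_waterFill_le hl (hp0 i) (hp1 i)))
  simp_rw [hmax]
  have hE : expectedDistortion (fun x => ∏ i, P i (x i)) patternDistortion (TestChannel.pi W) = D := by
    rw [expectedDistortion_pi P hPs]
    simp_rw [hW1]
    rw [hD, hsum0]; ring
  have hI : mutualInformation (fun x => ∏ i, P i (x i)) (TestChannel.pi W) =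
      ∑ i, (binaryEntropyBits (p i) - binaryEntropyBits (waterFill l (p i))) := by
    rw [mutualInformation_pi P hPn hPs]
    simp_rw [hW2]
  refine ⟨hE, hI, le_antisymm ?_ (le_rateDistortion fun Q h => ?_)⟩
  · rw [← hI]
    exact rateDistortion_le _ hE.le
  · rw [expectedDistortion_patternDistortion P hPs, hsum0] at h
    have := converse P p hp0 hp1 hP0 hP1 Q hl (by rw [hD]; linarith)
    simp only [binaryEntropyBits, ← sub_div, ← Finset.sum_div]
    rwa [div_le_iff₀' (Real.log_pos one_lt_two)]

theorem mainTheorem3 {Ω : Type*} [MeasurableSpace Ω] (μ : Measure Ω) [IsProbabilityMeasure μ]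
    (n : ℕ) (X : Fin n → Ω → Fin 2) (hX : ∀ i, Measurable (X i)) (hindep : iIndepFun X μ)
    (p : Fin n → ℝ) (hp : ∀ i, p i = μ.real {ω | X i ω = 1}) :
    -- the formula and an optimal test channel, for every admissible water level `l`
    (∀ D l : ℝ, 0 ≤ l → ∑ i, waterFill l (p i) = D + ∑ i, p i - n →
      rateDistortion (wordLaw μ X) patternDistortion D =
        ((∑ i, max (binaryEntropyBits (p i) - binaryEntropyBits (waterFill l (p i))) 0 : ℝ) :
          EReal) ∧
      ∃ W : Fin n → TestChannel (Fin 2) (Fin 2),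
        expectedDistortion (wordLaw μ X) patternDistortion (TestChannel.pi W) = D ∧
        ((mutualInformation (wordLaw μ X) (TestChannel.pi W) : ℝ) : EReal) =
          rateDistortion (wordLaw μ X) patternDistortion D ∧
        ∀ i,
          waterFill l (p i) =
            expectedDistortion (letterLaw μ (X i)) letterDistortion (W i) + p i - 1 ∧
          (waterFill l (p i) ≠ 1 / 2 →
            outputProb (letterLaw μ (X i)) (W i) 0 =
              (1 - p i - waterFill l (p i)) / (1 - 2 * waterFill l (p i)) ∧
            outputProb (letterLaw μ (X i)) (W i) 1 =
              (p i - waterFill l (p i)) / (1 - 2 * waterFill l (p i)))) ∧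
    -- a water level exists exactly on the nontrivial range of `D`
    (∀ D : ℝ, (∃ l : ℝ, 0 ≤ l ∧ ∑ i, waterFill l (p i) = D + ∑ i, p i - n) ↔
      ∑ i, (1 - p i) ≤ D ∧ D ≤ ∑ i, (1 - p i) + ∑ i, min (p i) (1 - p i)) ∧
    -- outside that range
    (∀ D : ℝ, D < ∑ i, (1 - p i) →
      rateDistortion (wordLaw μ X) patternDistortion D = ⊤) ∧
    (∀ D : ℝ, ∑ i, (1 - p i) + ∑ i, min (p i) (1 - p i) < D →
      rateDistortion (wordLaw μ X) patternDistortion D = 0) := by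
  have hlaw1 : ∀ i, letterLaw μ (X i) 1 = p i := fun i => (hp i).symm
  have hlaw0 : ∀ i, letterLaw μ (X i) 0 = 1 - p i := by
    intro i
    have h := probReal_compl_eq_one_sub (μ := μ) (hX i (MeasurableSet.singleton 1))
    rw [hp i]
    refine Eq.trans ?_ h
    unfold letterLaw
    congr 1
    ext ω
    simp only [Set.mem_ofPred_eq, Set.mem_compl_iff, Set.mem_preimage, Set.mem_singleton_iff]
    omega
  have hp0 : ∀ i, 0 ≤ p i := fun i => by rw [hp i]; exact measureReal_nonneg
  have hp1 : ∀ i, p i ≤ 1 := fun i => by rw [hp i]; exact measureReal_le_one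
  have hPn : ∀ i a, 0 ≤ letterLaw μ (X i) a := fun i a => measureReal_nonneg
  have hPs : ∀ i, ∑ a, letterLaw μ (X i) a = 1 := by intro i; simp [hlaw0, hlaw1]
  have hn : ∑ i, (1 - p i) = n - ∑ i, p i := by simp
  have hiff : ∀ D : ℝ, (∃ l : ℝ, 0 ≤ l ∧ ∑ i, waterFill l (p i) = D + ∑ i, p i - n) ↔
      ∑ i, (1 - p i) ≤ D ∧ D ≤ ∑ i, (1 - p i) + ∑ i, min (p i) (1 - p i) := by
    intro D
    rw [exists_waterFill_sum_eq_iff p hp0 hp1, hn]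
    constructor <;> rintro ⟨h1, h2⟩ <;> constructor <;> linarith
  rw [wordLaw_eq_prod μ X hindep]
  refine ⟨fun D l hl hD => ?_, hiff, fun D hD => ?_, fun D hD => ?_⟩
  · choose W hW1 hW2 hW3 using fun i =>
      exists_letter_channel hl (letterLaw μ (X i)) (hlaw0 i) (hlaw1 i)
    obtain ⟨hE, hI, hR⟩ := rateDistortion_pattern (fun i => letterLaw μ (X i)) p hp0 hp1 hlaw0
      hlaw1 hl hD W hW1 hW2
    refine ⟨hR, W, hE, by rw [hR, hI], fun i => ⟨?_, hW3 i⟩⟩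
    rw [expectedDistortion_letterDistortion, hW1, hlaw0]
    ring
  -- The source-only part of the distortion already exceeds `D`, and the Hamming part is
  -- nonnegative.
  · refine rateDistortion_eq_top fun Q => hD.trans_le ?_
    rw [expectedDistortion_patternDistortion _ hPs]
    simp_rw [hlaw0]
    refine le_add_of_nonneg_right (Finset.sum_nonneg fun x _ => Finset.sum_nonneg fun y _ => ?_)
    exact mul_nonneg (mul_nonneg (Finset.prod_nonneg fun i _ => hPn _ _) (Q.nonneg _ _))
      (Finset.sum_nonneg fun i _ => letterHamming_nonneg _ _)
  -- Level `1 / 2` saturates every letter, giving a zero-rate channel whose distortion is the upper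
  -- end of the range, hence below `D`.
  · have hl : (0 : ℝ) ≤ 1 / 2 := by norm_num
    have hsat : ∀ i, waterFill (1 / 2) (p i) = min (p i) (1 - p i) := fun i => by
      rw [waterFill_eq_min, min_eq_right (min_one_sub_le_half _)]
    choose W hW1 hW2 _ using fun i =>
      exists_letter_channel hl (letterLaw μ (X i)) (hlaw0 i) (hlaw1 i)
    have hE := expectedDistortion_pi (fun i => letterLaw μ (X i)) hPs W
    have hI := mutualInformation_pi (fun i => letterLaw μ (X i)) hPn hPs W
    simp_rw [hW2, hsat, binaryEntropyBits, binEntropy_min, sub_self, Finset.sum_const_zero] at hI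
    simp_rw [hW1, hsat, hlaw0] at hE
    refine le_antisymm ?_ ?_
    · refine (rateDistortion_le _ (hE.le.trans hD.le)).trans ?_
      rw [hI, EReal.coe_zero]
    · rw [← EReal.coe_zero]
      refine le_rateDistortion fun Q _ => mutualInformation_nonneg (fun x => ?_) ?_ Q
      · exact Finset.prod_nonneg fun i _ => hPn i (x i)
      · exact sum_prod_eq_one (fun i => letterLaw μ (X i)) hPs
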